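/- Fix $n \ge 1$ and consider Boolean variables $x_{ij}$, $i\in\{1,\dots,n\}$, $j\in\{1,\dots,2n\}$, together with twin variables $\bar x_{ij}$. Let $\mathrm{ks}_i = \sum_{j=1}^{2n} x_{ij} - n$, and let $Q_n$ be the set of polynomial constraints $$\mathrm{ks}_1 = 1/2;\qquad \mathrm{ks}_i^2 = \mathrm{ks}_{i+1}\ \ (1\le i\le n-1);\qquad \mathrm{ks}_n^2 = 0 .$$ A Polynomial Calculus Resolution refutation over $\mathbb{Q}$ (PCR/$\mathbb{Q}$ refutation) of $Q_n$ is a finite sequence $p_1,\dots,p_\ell$ of polynomials with rational coefficients in the variables $x_{ij},\bar x_{ij}$ such that $p_\ell = 1$ and each $p_i$ is (a) a constraint of $Q_n$, written as a polynomial that is required to vanish; or (b) a logical axiom $x_{ij}^2-x_{ij}$ or $x_{ij}+\bar x_{ij}-1$; or (c) a lift $p_i = y\,p_j$ for some $j<i$ and some variable $y$; or (d) a linear combination $p_i = a p_j + b p_k$ with $j,k<i$ and $a,b\in\mathbb{Q}$. Its bit-complexity is the minimum length of a bit-string that represents all the polynomials $p_1,\dots,p_\ell$ (as lists of monomials with coefficients)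 and all the scalars $a,b$ used in the linear combination rule, where all coefficients and scalars are represented by their reduced fractions written in binary. Theorem. Every PCR/$\mathbb{Q}$ refutation of $Q_n$ has bit-complexity $2^{\Omega(n)}$. That is, there are a constant $c>0$ and an $N$ such that for every $n\ge N$, every PCR/$\mathbb{Q}$ refutation of $Q_n$ has bit-complexity at least $2^{cn}$. -/

import Mathlib

open MvPolynomial

noncomputable section

namespace PCR

/-! ### Polynomial Calculus Resolution over the rationals -/

/-- Rational polynomials over pairs of twin Boolean variables indexed by `ι`:
`X (Sum.inl i)` is the variable `x_i` and `X (Sum.inr i)` is its twin `x̄_i`. -/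
abbrev TwinPoly (ι : Type) : Type := MvPolynomial (ι ⊕ ι) ℚ

/-- The logical axioms `x_i ^ 2 - x_i` and `x_i + x̄_i - 1`. -/
def logicalAxioms (ι : Type) : Set (TwinPoly ι) :=
  {q | ∃ i : ι, q = X (Sum.inl i) ^ 2 - X (Sum.inl i) ∨
    q = X (Sum.inl i) + X (Sum.inr i) - 1}

/-- The ways in which a line of a proof can be obtained; `m` is the number of lines. -/
inductive Rule (ι : Type) (m : ℕ) : Type
  | nonLogical : Rule ι m
  | logical : Rule ι m
  | lift (j : Fin m) (x : ι ⊕ ι) : Rule ι m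
  | linComb (j k : Fin m) (a b : ℚ) : Rule ι m

/-- The line `p i` is obtained by the given rule from the axioms or from earlier lines. -/
def Justifies {ι : Type} {m : ℕ} (Q : Set (TwinPoly ι)) (p : Fin m → TwinPoly ι) (i : Fin m) :
    Rule ι m → Prop
  | Rule.nonLogical => p i ∈ Q
  | Rule.logical => p i ∈ logicalAxioms ι
  | Rule.lift j x => j < i ∧ p i = X x * p j
  | Rule.linComb j k a b => j < i ∧ k < i ∧ p i = C a * p j + C b * p k

/-- The sequence of polynomials `p` is a PCR/ℚ proof of `f = 0` from
the constraints `q = 0`, `q ∈ Q`. -/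
def IsProof {ι : Type} {ℓ : ℕ} (Q : Set (TwinPoly ι)) (f : TwinPoly ι)
    (p : Fin (ℓ + 1) → TwinPoly ι) : Prop :=
  (∀ i, ∃ r : Rule ι (ℓ + 1), Justifies Q p i r) ∧ p (Fin.last ℓ) = f

/-- A PCR/ℚ refutation of `Q` is a proof of `1 = 0` from `Q`. -/
def IsRefutation {ι : Type} {ℓ : ℕ} (Q : Set (TwinPoly ι)) (p : Fin (ℓ + 1) → TwinPoly ι) : Prop :=
  IsProof Q 1 p

/-! ### Representing proofs by bit-strings -/

/-- The binary expansion of `k`, made self-delimiting: each digit is preceded by `true`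
and the end is marked by `false`. -/
def encodeNat (k : ℕ) : List Bool :=
  (Nat.bits k).flatMap (fun b => [true, b]) ++ [false]

/-- The reduced fraction of `q`: sign, numerator and denominator, in binary. -/
def encodeRat (q : ℚ) : List Bool :=
  decide (q < 0) :: (encodeNat q.num.natAbs ++ encodeNat q.den)

/-- A monomial: the list of its variables with their exponents, all in binary.
(The length does not depend on the order of the variables.) -/
def encodeMonomial {ι : Type} [Encodable ι] (m : (ι ⊕ ι) →₀ ℕ) : List Bool :=
  m.support.toList.flatMap
    (fun x => true :: (encodeNat (Encodable.encode x) ++ encodeNat (m x))) ++ [false]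

/-- A polynomial: the list of its monomials with their non-zero coefficients.
(The length does not depend on the order of the monomials.) -/
def encodePoly {ι : Type} [Encodable ι] (p : TwinPoly ι) : List Bool :=
  p.support.toList.flatMap
    (fun m => true :: (encodeMonomial m ++ encodeRat (p.coeff m))) ++ [false]

/-- The scalars that a rule uses (none, except in the linear combination rule). -/
def encodeScalars {ι : Type} {m : ℕ} : Rule ι m → List Bool
  | Rule.linComb _ _ a b => true :: (encodeRat a ++ encodeRat b)
  | _ => [false]

/-- All the polynomials of a sequence, together with all the scalars used in
the linear combination rule. -/
def encodeProof {ι : Type} [Encodable ι] {m : ℕ} (p : Fin m → TwinPoly ι)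
    (r : Fin m → Rule ι m) : List Bool :=
  (List.finRange m).flatMap (fun i => true :: (encodePoly (p i) ++ encodeScalars (r i)))
    ++ [false]

/-- The bit-complexity of a proof `p` from `Q`: the minimum length of a bit-string that
represents all the polynomials of `p` and the scalars of the linear combinations, over all
choices of rules (and scalars) by which the lines of `p` can be obtained.
(If `p` is a proof from `Q`, there is such a choice, so that the minimum is attained.) -/
def bitComplexity {ι : Type} [Encodable ι] {m : ℕ} (Q : Set (TwinPoly ι))
    (p : Fin m → TwinPoly ι) : ℕ :=
  sInf {b : ℕ | ∃ r : Fin m → Rule ι m,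
    (∀ i, Justifies Q p i (r i)) ∧ (encodeProof p r).length = b}

/-! ### The constraints -/

/-- The polynomial `ks_i = ∑_j x_{ij} - n`, where `j` ranges over `2 n` indices. -/
def ks {n : ℕ} (i : Fin n) : TwinPoly (Fin n × Fin (2 * n)) :=
  ∑ j : Fin (2 * n), X (Sum.inl (i, j)) - C (n : ℚ)

/-- The constraints `ks_1 = 1/2`, `ks_i ^ 2 = ks_{i+1}` for `1 ≤ i < n` and `ks_n ^ 2 = 0`,
each as the polynomial that is required to vanish. (Indices in `Fin n` start at `0`.) -/
def constraintsQ (n : ℕ) : Set (TwinPoly (Fin n × Fin (2 * n))) :=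
  {q | (∃ i : Fin n, (i : ℕ) = 0 ∧ q = ks i - C (1 / 2)) ∨
    (∃ i j : Fin n, (j : ℕ) = (i : ℕ) + 1 ∧ q = ks i ^ 2 - ks j) ∨
    (∃ i : Fin n, (i : ℕ) + 1 = n ∧ q = ks i ^ 2)}

end PCR

end

/-! The constraints other than the last force `ks_i` to act as `ksValue i = (1/2)^(2^i)`, with `i`
starting at `0`. So only `ks_n ^ 2 = 0` is violated, and only by a doubly exponentially small
amount. The proof shows that a refutation must amplify this amount to `1`, and that the
amplification is paid for in bits of scalars.

Let the rows be independent, each "uniform" on Boolean vectors whose coordinate sum is the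
fractional number that gives `ks_i` its value. No such distribution exists, but the hypergeometric
formulas for its moments still make sense. By `exists_gram` and `pseudoExp_sq_nonneg`, the resulting
functional `E` is nonnegative on squares of polynomials with few variables in each row. `E` vanishes
on the squares of all axioms but the last constraint, where it equals `(1/2)^(2^(n+1))`
(`ksExp_constraint_sq_le`). Along a proof (`sq_le_of_justifies`), a lift does not increase `E(p^2)`,
and a linear combination costs a factor of at most `2(a^2+b^2)`. As `E(1) = 1`, the scalars need
`2^(n+1)` bits.

This requires lines with few variables in each row. If there are fewer than `(16/15)^(n/2)`
monomials, `exists_balanced_restriction` kills all wide ones by a partial assignment that preserves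
the shape of `ks_i`. Otherwise the monomials alone give the bound. -/

noncomputable section

namespace PCR

/-! ### Fractional hypergeometric moments -/

/-- The mixed moment of `j` coordinates being `0` and `k` other coordinates being `1`, for the
formal uniform distribution on the points of `{0,1}^N` with coordinate sum `r`. -/
def mixedMoment (N : ℕ) (r : ℚ) (j k : ℕ) : ℚ :=
  (∏ i ∈ Finset.range j, ((N : ℚ) - r - i)) * (∏ i ∈ Finset.range k, (r - i)) /
    ∏ i ∈ Finset.range (j + k), ((N : ℚ) - i)

lemma mixedMoment_zero (N : ℕ) (r : ℚ) : mixedMoment N r 0 0 = 1 := by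
  simp [mixedMoment]

lemma cast_sub_ne_zero_of_lt {N k : ℕ} (h : k < N) : (N : ℚ) - k ≠ 0 := by
  have : (k : ℚ) < N := by exact_mod_cast h
  linarith

lemma prod_range_cast_sub_pos {N t : ℕ} (h : t ≤ N) :
    0 < ∏ i ∈ Finset.range t, ((N : ℚ) - i) := by
  refine Finset.prod_pos fun i hi => ?_
  have : (i : ℚ) < N := by exact_mod_cast (Finset.mem_range.1 hi).trans_le h
  linarith

/-- Conditioning on one fresh coordinate, which is `0` or `1`. -/
lemma mixedMoment_eq_add {N j k : ℕ} (r : ℚ) (h : j + k < N) :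
    mixedMoment N r j k = mixedMoment N r (j + 1) k + mixedMoment N r j (k + 1) := by
  have h1 := cast_sub_ne_zero_of_lt h
  have h2 := (prod_range_cast_sub_pos h.le).ne'
  rw [mixedMoment, mixedMoment, mixedMoment, show j + 1 + k = j + k + 1 by ring,
    show j + (k + 1) = j + k + 1 by ring, Finset.prod_range_succ _ (j + k),
    Finset.prod_range_succ _ j, Finset.prod_range_succ _ k]
  field_simp
  push_cast
  ring

lemma mul_mixedMoment_succ {N k : ℕ} (r : ℚ) (h : k < N) :
    ((N : ℚ) - k) * mixedMoment N r 0 (k + 1) = (r - k) * mixedMoment N r 0 k := by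
  have h1 := cast_sub_ne_zero_of_lt h
  have h2 := (prod_range_cast_sub_pos h.le).ne'
  rw [mixedMoment, mixedMoment, zero_add, zero_add, Finset.prod_range_succ _ k,
    Finset.prod_range_succ _ k]
  field_simp

/-- Condition on `W.card` fresh coordinates; `J` is the set of those that are `0`. Only the size of
`W` matters. -/
lemma mixedMoment_eq_sum_powerset {α : Type*} [DecidableEq α] {N : ℕ} (r : ℚ) (W : Finset α) :
    ∀ j k : ℕ, j + k + W.card ≤ N → mixedMoment N r j k =
      ∑ J ∈ W.powerset, mixedMoment N r (j + J.card) (k + W.card - J.card) := by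
  induction W using Finset.induction_on with
  | empty => intro j k _; simp
  | insert a W ha ih =>
    intro j k h
    rw [Finset.card_insert_of_notMem ha] at h
    rw [Finset.sum_powerset_insert ha, mixedMoment_eq_add r (by omega),
      ih (j + 1) k (by omega), ih j (k + 1) (by omega), add_comm]
    congr 1
    · refine Finset.sum_congr rfl fun J hJ => ?_
      rw [Finset.card_insert_of_notMem ha]
      congr 1
      omega
    · refine Finset.sum_congr rfl fun J hJ => ?_
      have hJ' := Finset.mem_powerset.1 hJ
      rw [Finset.card_insert_of_notMem ha, Finset.card_insert_of_notMem fun h => ha (hJ' h)]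
      congr 1 <;> omega

lemma mixedMoment_nonneg {N j k : ℕ} {r : ℚ} (hj : (j : ℚ) ≤ N - r + 1) (hk : (k : ℚ) ≤ r + 1)
    (h : j + k ≤ N) : 0 ≤ mixedMoment N r j k := by
  refine div_nonneg (mul_nonneg ?_ ?_) (prod_range_cast_sub_pos h).le
  · refine Finset.prod_nonneg fun i hi => ?_
    have : (i : ℚ) + 1 ≤ j := by exact_mod_cast Finset.mem_range.1 hi
    linarith
  · refine Finset.prod_nonneg fun i hi => ?_
    have : (i : ℚ) + 1 ≤ k := by exact_mod_cast Finset.mem_range.1 hi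
    linarith

section Row

variable {κ : Type*} [Fintype κ] [DecidableEq κ]

lemma sum_mixedMoment_card_insert (r : ℚ) (A : Finset κ) (h : A.card < Fintype.card κ) :
    ∑ c, mixedMoment (Fintype.card κ) r 0 (insert c A).card =
      r * mixedMoment (Fintype.card κ) r 0 A.card := by
  rw [← Finset.sum_add_sum_compl A, Finset.sum_congr rfl (g := fun _ =>
    mixedMoment (Fintype.card κ) r 0 A.card) fun c hc => by rw [Finset.insert_eq_of_mem hc],
    Finset.sum_congr (s₁ := Aᶜ) rfl (g := fun _ =>
    mixedMoment (Fintype.card κ) r 0 (A.card + 1)) fun c hc => by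
      rw [Finset.card_insert_of_notMem (Finset.mem_compl.1 hc)]]
  have := mul_mixedMoment_succ r h
  rw [Finset.sum_const, Finset.sum_const, Finset.card_compl, nsmul_eq_mul, nsmul_eq_mul,
    Nat.cast_sub h.le, this]
  ring

/-- Modulo `∑ x = r`, a monomial of degree at most `d` is a combination of multilinear monomials
of degree exactly `d`. -/
lemma exists_homogenization (r : ℚ) {d : ℕ} (hN : 2 * d ≤ Fintype.card κ)
    (hr : ∀ a < d, r ≠ a) (A : Finset κ) (hA : A.card ≤ d) :
    ∃ f : Finset κ → ℚ, ∀ B : Finset κ, B.card ≤ d →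
      mixedMoment (Fintype.card κ) r 0 (A ∪ B).card =
        ∑ U ∈ Finset.powersetCard d Finset.univ,
          f U * mixedMoment (Fintype.card κ) r 0 (U ∪ B).card := by
  induction hk : d - A.card generalizing A with
  | zero =>
    refine ⟨fun U => if U = A then 1 else 0, fun B hB => ?_⟩
    have hAd : A.card = d := by omega
    simp [hAd]
  | succ k ih =>
    have hlt : A.card < d := by omega
    have hra := hr _ hlt
    choose! f hf using fun c (hc : c ∈ Aᶜ) =>
      have hc' : c ∉ A := Finset.mem_compl.1 hc
      ih (insert c A) (by rw [Finset.card_insert_of_notMem hc']; omega)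
        (by rw [Finset.card_insert_of_notMem hc']; omega)
    -- Multiply `∑ x = r` by `x_A`: the columns in `A` contribute `|A| x_A`, so `(r - |A|) x_A =
    -- ∑_{c ∉ A} x_{A ∪ {c}}`.
    refine ⟨fun U => (r - A.card)⁻¹ * ∑ c ∈ Aᶜ, f c U, fun B hB => ?_⟩
    have h0 := Finset.card_union_le A B
    have h1 := sum_mixedMoment_card_insert r (A ∪ B) (by omega)
    rw [← Finset.sum_add_sum_compl A, Finset.sum_congr rfl (g := fun _ =>
      mixedMoment (Fintype.card κ) r 0 (A ∪ B).card) fun c hc => by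
        rw [Finset.insert_eq_of_mem (Finset.mem_union_left _ hc)],
      Finset.sum_const, nsmul_eq_mul] at h1
    have h2 : ∑ c ∈ Aᶜ, mixedMoment (Fintype.card κ) r 0 (insert c (A ∪ B)).card =
        ∑ U ∈ Finset.powersetCard d Finset.univ,
          (∑ c ∈ Aᶜ, f c U) * mixedMoment (Fintype.card κ) r 0 (U ∪ B).card := by
      simp_rw [Finset.sum_mul]
      rw [Finset.sum_comm]
      refine Finset.sum_congr rfl fun c hc => ?_
      rw [← Finset.insert_union, hf c hc B hB]
    simp_rw [mul_assoc]
    rw [← Finset.mul_sum, ← h2, eq_inv_mul_iff_mul_eq₀ (sub_ne_zero.2 hra)]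
    linarith

/-- The moments of degree at most `d` on each side form a Gram matrix. -/
lemma exists_gram (r : ℚ) {d : ℕ} (hN : 2 * d ≤ Fintype.card κ) (h1 : 2 * (d : ℚ) ≤ r + 1)
    (h2 : (d : ℚ) ≤ Fintype.card κ - r + 1) (hr : ∀ a < d, r ≠ a) :
    ∃ (w : Finset κ → ℚ) (f : Finset κ → Finset κ → ℚ), (∀ J, 0 ≤ w J) ∧
      ∀ A B : Finset κ, A.card ≤ d → B.card ≤ d →
        mixedMoment (Fintype.card κ) r 0 (A ∪ B).card = ∑ J, w J * f J A * f J B := by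
  choose! g hg using fun (A : Finset κ) (hA : A.card ≤ d) => exists_homogenization r hN hr A hA
  -- `w J` is the moment of `J` being `0` and `2d - |J|` further coordinates being `1`. Larger `J`
  -- lie in no `d`-set, so weight `0` is harmless there and keeps `w` nonnegative.
  refine ⟨fun J => if J.card ≤ d then
    mixedMoment (Fintype.card κ) r J.card (2 * d - J.card) else 0,
    fun J A => ∑ U ∈ Finset.powersetCard d Finset.univ, if J ⊆ U then g A U else 0,
    fun J => ?_, fun A B hA hB => ?_⟩
  · dsimp only
    split_ifs with h
    · refine mixedMoment_nonneg ?_ ?_ (by omega)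
      · have : (J.card : ℚ) ≤ d := by exact_mod_cast h
        linarith
      · have : ((2 * d - J.card : ℕ) : ℚ) ≤ 2 * d := by exact_mod_cast Nat.sub_le _ _
        linarith
    · exact le_rfl
  · have key : ∀ U ∈ Finset.powersetCard d (Finset.univ : Finset κ),
        ∀ V ∈ Finset.powersetCard d (Finset.univ : Finset κ),
        mixedMoment (Fintype.card κ) r 0 (V ∪ U).card =
          ∑ J, (if J ⊆ U then if J ⊆ V then (if J.card ≤ d then
            mixedMoment (Fintype.card κ) r J.card (2 * d - J.card) else 0) else 0 else 0) := by
      intro U hU V hV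
      have hU := (Finset.mem_powersetCard.1 hU).2
      have hV := (Finset.mem_powersetCard.1 hV).2
      have hc := Finset.card_union_add_card_inter V U
      -- Adding `|V ∩ U|` fresh coordinates brings the total to exactly `2d`, so the summand depends
      -- on `J` alone and not on `U` and `V`.
      rw [mixedMoment_eq_sum_powerset r (V ∩ U) 0 _ (by omega), ← Finset.sum_filter,
        ← Finset.sum_filter]
      refine Finset.sum_congr ?_ fun J hJ => ?_
      · ext J
        rw [Finset.mem_powerset, Finset.subset_inter_iff, Finset.mem_filter, Finset.mem_filter]
        simp [and_comm]
      · have hJ := (Finset.mem_filter.1 hJ).2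
        have : J.card ≤ d := by
          rw [← hV]; exact Finset.card_le_card hJ
        rw [if_pos this, zero_add]
        congr 1
        omega
    rw [hg A hA B hB]
    have step : ∀ U ∈ Finset.powersetCard d (Finset.univ : Finset κ),
        g A U * mixedMoment (Fintype.card κ) r 0 (U ∪ B).card =
          ∑ V ∈ Finset.powersetCard d Finset.univ, ∑ J : Finset κ,
            (if J.card ≤ d then
              mixedMoment (Fintype.card κ) r J.card (2 * d - J.card) else 0) *
            (if J ⊆ U then g A U else 0) * (if J ⊆ V then g B V else 0) := by
      intro U hU
      rw [Finset.union_comm, hg B hB U (Finset.mem_powersetCard.1 hU).2.le, Finset.mul_sum]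
      refine Finset.sum_congr rfl fun V hV => ?_
      rw [key U hU V hV, Finset.mul_sum, Finset.mul_sum]
      refine Finset.sum_congr rfl fun J _ => ?_
      by_cases hJU : J ⊆ U <;> by_cases hJV : J ⊆ V <;> simp only [hJU, hJV, if_true, if_false] <;>
        ring
    rw [Finset.sum_congr rfl step]
    simp_rw [Finset.mul_sum, Finset.sum_mul]
    rw [Finset.sum_congr rfl fun U _ => Finset.sum_comm, Finset.sum_comm]
    refine Finset.sum_congr rfl fun J _ => ?_
    rw [Finset.sum_comm]

end Row

/-! ### The pseudo-expectation -/

section PseudoExpectation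

variable {ι κ : Type*} [Fintype κ]

/-- The columns of the variables that occur in row `i` of a monomial. -/
def rowSupport (m : ι × κ →₀ ℕ) (i : ι) : Finset κ := Finset.univ.filter fun c => m (i, c) ≠ 0

lemma rowSupport_zero (i : ι) : rowSupport (0 : ι × κ →₀ ℕ) i = ∅ := by
  simp [rowSupport]

lemma rowSupport_add [DecidableEq κ] (m m' : ι × κ →₀ ℕ) (i : ι) :
    rowSupport (m + m') i = rowSupport m i ∪ rowSupport m' i := by
  ext c
  simp [rowSupport]
  tauto

lemma rowSupport_single_self (i : ι) (c : κ) {k : ℕ} (hk : k ≠ 0) :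
    rowSupport (Finsupp.single (i, c) k) i = {c} := by
  classical
  ext c'
  simp [rowSupport, Finsupp.single_apply, hk, eq_comm]

lemma rowSupport_single_of_ne {i i' : ι} (h : i' ≠ i) (c : κ) (k : ℕ) :
    rowSupport (Finsupp.single (i, c) k) i' = ∅ := by
  classical
  ext c'
  simp [rowSupport, h.symm]

lemma card_rowSupport_le_degree (m : ι × κ →₀ ℕ) (i : ι) : (rowSupport m i).card ≤ m.degree := by
  classical
  have h : (rowSupport m i).card ≤ m.support.card := by
    refine Finset.card_le_card_of_injOn (fun c => (i, c)) (fun c hc => ?_) (fun c _ c' _ h => ?_)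
    · simpa [rowSupport] using hc
    · exact (Prod.ext_iff.1 h).2
  refine h.trans ?_
  rw [Finsupp.degree_apply, Finset.card_eq_sum_ones]
  exact Finset.sum_le_sum fun v hv => Nat.one_le_iff_ne_zero.2 (Finsupp.mem_support_iff.1 hv)

/-- The polynomials whose monomials have at most `d` variables in each row. -/
def rowDegreeLE (ι κ : Type*) [Fintype κ] (d : ℕ) : Submodule ℚ (MvPolynomial (ι × κ) ℚ) :=
  restrictSupport ℚ {m | ∀ i, (rowSupport m i).card ≤ d}

lemma mem_rowDegreeLE {d : ℕ} {q : MvPolynomial (ι × κ) ℚ} :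
    q ∈ rowDegreeLE ι κ d ↔ ∀ m ∈ q.support, ∀ i, (rowSupport m i).card ≤ d :=
  Iff.rfl

variable [Fintype ι]

/-- The linear functional under which the rows are independent and row `i` is uniformly
distributed on the Boolean vectors with coordinate sum `r i`. -/
def pseudoExp (r : ι → ℚ) : MvPolynomial (ι × κ) ℚ →ₗ[ℚ] ℚ :=
  (basisMonomials (ι × κ) ℚ).constr ℚ fun m =>
    ∏ i, mixedMoment (Fintype.card κ) (r i) 0 (rowSupport m i).card

lemma pseudoExp_monomial (r : ι → ℚ) (m : ι × κ →₀ ℕ) (a : ℚ) :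
    pseudoExp r (monomial m a) =
      a * ∏ i, mixedMoment (Fintype.card κ) (r i) 0 (rowSupport m i).card := by
  have h : monomial m a = a • basisMonomials (ι × κ) ℚ m := by
    rw [coe_basisMonomials, smul_monomial, smul_eq_mul, mul_one]
  rw [h, map_smul, pseudoExp, Module.Basis.constr_basis, smul_eq_mul]

lemma pseudoExp_one (r : ι → ℚ) : pseudoExp (κ := κ) r 1 = 1 := by
  rw [← C_1, C_apply, pseudoExp_monomial]
  simp [rowSupport_zero, mixedMoment_zero]

lemma pseudoExp_X_sq_mul (r : ι → ℚ) (v : ι × κ) (q : MvPolynomial (ι × κ) ℚ) :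
    pseudoExp r (X v ^ 2 * q) = pseudoExp r (X v * q) := by
  classical
  induction q using MvPolynomial.induction_on' with
  | monomial u a =>
    rw [X_pow_eq_monomial, X, monomial_mul, monomial_mul, pseudoExp_monomial, pseudoExp_monomial]
    congr 1
    refine Finset.prod_congr rfl fun i _ => ?_
    rw [rowSupport_add, rowSupport_add]
    obtain ⟨i', c⟩ := v
    by_cases h : i = i'
    · subst h
      rw [rowSupport_single_self _ _ two_ne_zero, rowSupport_single_self _ _ one_ne_zero]
    · rw [rowSupport_single_of_ne h, rowSupport_single_of_ne h]
  | add p q hp hq => rw [mul_add, mul_add, map_add, map_add, hp, hq]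

/-- Up to degree less than the number of columns, the sum of row `i` acts as the number `r i`. -/
lemma pseudoExp_sum_row_mul (r : ι → ℚ) (i : ι) {q : MvPolynomial (ι × κ) ℚ}
    (hq : q.totalDegree < Fintype.card κ) :
    pseudoExp r ((∑ c, X (i, c)) * q) = r i * pseudoExp r q := by
  classical
  conv_lhs => rw [q.as_sum]
  conv_rhs => rw [q.as_sum]
  rw [Finset.mul_sum, map_sum, map_sum, Finset.mul_sum]
  refine Finset.sum_congr rfl fun u hu => ?_
  have hu' : (rowSupport u i).card < Fintype.card κ := by
    refine ((card_rowSupport_le_degree u i).trans ?_).trans_lt hq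
    simpa [Finsupp.degree_apply, Finsupp.sum] using le_totalDegree hu
  rw [Finset.sum_mul, map_sum, pseudoExp_monomial]
  have h : ∀ c, pseudoExp r (X (i, c) * monomial u (coeff u q)) = coeff u q *
      (mixedMoment (Fintype.card κ) (r i) 0 (insert c (rowSupport u i)).card *
        ∏ i' ∈ Finset.univ.erase i,
          mixedMoment (Fintype.card κ) (r i') 0 (rowSupport u i').card) := by
    intro c
    rw [X, monomial_mul, one_mul, pseudoExp_monomial,
      ← Finset.mul_prod_erase _ _ (Finset.mem_univ i), rowSupport_add,
      rowSupport_single_self _ _ one_ne_zero, ← Finset.insert_eq]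
    congr 2
    refine Finset.prod_congr rfl fun i' hi' => ?_
    rw [rowSupport_add, rowSupport_single_of_ne (Finset.ne_of_mem_erase hi'), Finset.empty_union]
  simp_rw [h]
  rw [← Finset.mul_sum, ← Finset.sum_mul, sum_mixedMoment_card_insert _ _ hu',
    ← Finset.mul_prod_erase _ _ (Finset.mem_univ i)]
  ring

/-- A product of the Gram forms of the rows is a Gram form indexed by tuples `J`, which turns the
value on `q ^ 2` into a weighted sum of squares. Only the width in each row is bounded, not the
total degree. -/
lemma pseudoExp_sq_nonneg (r : ι → ℚ) {d : ℕ} (hN : 2 * d ≤ Fintype.card κ)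
    (h1 : ∀ i, 2 * (d : ℚ) ≤ r i + 1) (h2 : ∀ i, (d : ℚ) ≤ Fintype.card κ - r i + 1)
    (hr : ∀ i, ∀ a < d, r i ≠ a) {q : MvPolynomial (ι × κ) ℚ} (hq : q ∈ rowDegreeLE ι κ d) :
    0 ≤ pseudoExp r (q ^ 2) := by
  classical
  choose w f hw hf using fun i => exists_gram (r i) hN (h1 i) (h2 i) (hr i)
  have key : pseudoExp r (q ^ 2) = ∑ J : ι → Finset κ,
      (∏ i, w i (J i)) * (∑ m ∈ q.support, coeff m q * ∏ i, f i (J i) (rowSupport m i)) ^ 2 := by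
    conv_lhs => rw [sq, q.as_sum]
    rw [Finset.sum_mul_sum, map_sum]
    simp_rw [sq, Finset.sum_mul_sum, Finset.mul_sum, map_sum]
    rw [Finset.sum_comm (s := Finset.univ)]
    refine Finset.sum_congr rfl fun m hm => ?_
    rw [Finset.sum_comm (s := Finset.univ)]
    refine Finset.sum_congr rfl fun m' hm' => ?_
    rw [monomial_mul, pseudoExp_monomial, Finset.prod_congr rfl fun i _ => by
      rw [rowSupport_add, hf i _ _ (mem_rowDegreeLE.1 hq m hm i) (mem_rowDegreeLE.1 hq m' hm' i)],
      Finset.prod_univ_sum, Fintype.piFinset_univ, Finset.mul_sum]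
    refine Finset.sum_congr rfl fun J _ => ?_
    rw [Finset.prod_mul_distrib, Finset.prod_mul_distrib]
    ring
  rw [key]
  exact Finset.sum_nonneg fun J _ =>
    mul_nonneg (Finset.prod_nonneg fun i _ => hw i _) (sq_nonneg _)

end PseudoExpectation

/-! ### Balanced restrictions that kill wide monomials -/

section Restriction

variable {α ι κ : Type*}

/-- Under the assignment `v` of the columns outside `F`, a literal of `a` vanishes. Here `R a i c b`
says that the literal in row `i` and column `c` that is `1` exactly on the value `b` occurs in `a`. -/
def Killed (R : α → ι → κ → Bool → Prop) (F : Finset κ) (v : κ → Bool) (a : α) : Prop :=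
  ∃ i c b, c ∉ F ∧ R a i c b ∧ v c ≠ b

/-- The columns in `F` that occur in row `i` of `a`. -/
def freeColumns (R : α → ι → κ → Bool → Prop) (F : Finset κ) (a : α) (i : ι) : Finset κ :=
  @Finset.filter _ (fun c => ∃ b, R a i c b) (Classical.decPred _) F

lemma mem_freeColumns {R : α → ι → κ → Bool → Prop} {F : Finset κ} {a : α} {i : ι} {c : κ} :
    c ∈ freeColumns R F a i ↔ c ∈ F ∧ ∃ b, R a i c b :=
  @Finset.mem_filter _ _ (Classical.decPred _) _ _

/-- There are more than `d` columns in `F` that occur in some row of `a`. -/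
def Wide (R : α → ι → κ → Bool → Prop) (F : Finset κ) (d : ℕ) (a : α) : Prop :=
  ∃ i, d < (freeColumns R F a i).card

lemma Killed.mono {R : α → ι → κ → Bool → Prop} {F F' : Finset κ} {v v' : κ → Bool} {a : α}
    (h : Killed R F v a) (hF : F' ⊆ F) (hv : ∀ c ∉ F, v' c = v c) : Killed R F' v' a := by
  obtain ⟨i, c, b, hc, hR, hb⟩ := h
  exact ⟨i, c, b, fun h => hc (hF h), hR, by rwa [hv c hc]⟩

lemma Wide.mono {R : α → ι → κ → Bool → Prop} {F F' : Finset κ} {d : ℕ} {a : α}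
    (h : Wide R F' d a) (hF : F' ⊆ F) : Wide R F d a := by
  obtain ⟨i, hi⟩ := h
  exact ⟨i, hi.trans_le (Finset.card_le_card fun c hc =>
    mem_freeColumns.2 ⟨hF (mem_freeColumns.1 hc).1, (mem_freeColumns.1 hc).2⟩)⟩

open Classical in
/-- Some literal over `F` occurs in a `(d + 1) / (2 |F|)` fraction of the wide elements. -/
lemma exists_frequent_literal (R : α → ι → κ → Bool → Prop) {F : Finset κ} (hF : F.Nonempty)
    (d : ℕ) (T : Finset α) (hT : ∀ a ∈ T, Wide R F d a) :
    ∃ c ∈ F, ∃ b, T.card * (d + 1) ≤ 2 * F.card * (T.filter fun a => ∃ i, R a i c b).card := by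
  have hne : (F ×ˢ (Finset.univ : Finset Bool)).Nonempty := hF.product Finset.univ_nonempty
  have hcard : (F ×ˢ (Finset.univ : Finset Bool)).card = 2 * F.card := by
    simp [mul_comm]
  obtain ⟨⟨c, b⟩, hcb, h⟩ := Finset.exists_max_image _
    (fun x : κ × Bool => (T.filter fun a => ∃ i, R a i x.1 x.2).card) hne
  refine ⟨c, (Finset.mem_product.1 hcb).1, b, ?_⟩
  rw [← hcard, ← smul_eq_mul (_ : ℕ) (Finset.card _)]
  -- Double counting of pairs (element, literal). Rows are ignored, so there are only `2|F|`
  -- literals.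
  refine le_trans ?_ (Finset.sum_le_card_nsmul _ _ _ h)
  simp_rw [Finset.card_filter]
  rw [Finset.sum_comm, ← smul_eq_mul]
  refine Finset.card_nsmul_le_sum _ _ _ fun a ha => ?_
  obtain ⟨i, hi⟩ := hT a ha
  rw [← Finset.card_filter]
  refine (Nat.succ_le_of_lt hi).trans ?_
  choose! b hb using fun c (hc : c ∈ freeColumns R F a i) => (mem_freeColumns.1 hc).2
  refine Finset.card_le_card_of_injOn (fun c => (c, b c)) (fun c hc => ?_)
    (fun c _ c' _ h => (Prod.ext_iff.1 h).1)
  simp only [Finset.coe_filter, Finset.mem_product, Finset.mem_univ, and_true, Set.mem_ofPred_eq]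
  exact ⟨(mem_freeColumns.1 hc).1, i, hb c hc⟩

-- Greedy choice: falsify the most frequent literal in all rows at once, which kills at least `1/16`
-- of the surviving wide elements, and give a second column the opposite value to keep zeros and
-- ones balanced.
open Classical in
lemma exists_balanced_restriction [Fintype κ] [DecidableEq κ] (R : α → ι → κ → Bool → Prop) (d : ℕ)
    (hd : Fintype.card κ ≤ 8 * (d + 1)) (T : Finset α) (s : ℕ) :
    2 * s ≤ Fintype.card κ → ∃ (F : Finset κ) (v : κ → Bool),
      F.card + 2 * s = Fintype.card κ ∧ (Fᶜ.filter fun c => v c = true).card = s ∧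
      (T.filter fun a => ¬ Killed R F v a ∧ Wide R F d a).card * 16 ^ s ≤ T.card * 15 ^ s := by
  induction s with
  | zero =>
    intro _
    refine ⟨Finset.univ, fun _ => true, by simp, by simp, ?_⟩
    simpa using Finset.card_filter_le _ _
  | succ s ih =>
    intro hs
    obtain ⟨F, v, hF, hv, hT⟩ := ih (by omega)
    set B := T.filter fun a => ¬ Killed R F v a ∧ Wide R F d a with hB
    obtain ⟨c, hc, b, hcb⟩ := exists_frequent_literal R (F := F)
      (Finset.card_pos.1 (by omega)) d B fun a ha => (Finset.mem_filter.1 ha).2.2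
    obtain ⟨c', hc'⟩ : (F.erase c).Nonempty := by
      rw [← Finset.card_pos, Finset.card_erase_of_mem hc]
      omega
    have hne : c' ≠ c := Finset.ne_of_mem_erase hc'
    have hcF' : c' ∈ F := Finset.mem_of_mem_erase hc'
    have hcard : ((F.erase c).erase c').card + 2 = F.card := by
      rw [Finset.card_erase_of_mem hc', Finset.card_erase_of_mem hc]
      omega
    have hsub : (F.erase c).erase c' ⊆ F :=
      (Finset.erase_subset _ _).trans (Finset.erase_subset _ _)
    set v' : κ → Bool := fun x => if x = c then !b else if x = c' then b else v x with hv'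
    have hvc : v' c = !b := by simp [hv']
    have hvc' : v' c' = b := by simp [hv', hne]
    have hvF : ∀ x ∉ F, v' x = v x := by
      intro x hx
      have h1 : x ≠ c := fun h => hx (h ▸ hc)
      have h2 : x ≠ c' := fun h => hx (h ▸ hcF')
      simp [hv', h1, h2]
    refine ⟨(F.erase c).erase c', v', by omega, ?_, ?_⟩
    · have : ((F.erase c).erase c')ᶜ = insert c (insert c' Fᶜ) := by
        ext x
        simp only [Finset.mem_compl, Finset.mem_erase, Finset.mem_insert]
        tauto
      rw [this, Finset.filter_insert, Finset.filter_insert, hvc, hvc',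
        Finset.filter_congr (q := fun x => v x = true) fun x hx => by
          rw [hvF x (Finset.mem_compl.1 hx)]]
      cases b
      · simp [hc, hv]
      · simp [hcF', hv]
    · have hle : (T.filter fun a => ¬ Killed R ((F.erase c).erase c') v' a ∧
          Wide R ((F.erase c).erase c') d a).card + (B.filter fun a => ∃ i, R a i c b).card ≤
          B.card := by
        rw [← Finset.card_filter_add_card_filter_not (s := B) (fun a => ∃ i, R a i c b), add_comm]
        refine Nat.add_le_add_left (Finset.card_le_card fun a ha => ?_) _
        obtain ⟨haT, hk, hw⟩ := Finset.mem_filter.1 ha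
        refine Finset.mem_filter.2 ⟨Finset.mem_filter.2
          ⟨haT, fun h => hk (h.mono hsub hvF), hw.mono hsub⟩, ?_⟩
        rintro ⟨i, hi⟩
        exact hk ⟨i, c, b, by simp, hi, by rw [hvc]; simp⟩
      set K := (B.filter fun a => ∃ i, R a i c b).card
      -- The frequency is at least `(d+1)/(2|F|)`, and `|F| ≤ 8(d+1)`.
      have hK : B.card ≤ 16 * K := by
        have h1 : F.card ≤ 8 * (d + 1) := by omega
        have h2 : B.card * (d + 1) ≤ 16 * K * (d + 1) := by
          calc _ ≤ _ := hcb
            _ ≤ 2 * (8 * (d + 1)) * K := by gcongr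
            _ = _ := by ring
        exact Nat.le_of_mul_le_mul_right h2 (Nat.succ_pos d)
      rw [pow_succ, pow_succ]
      calc _ = _ * 16 * 16 ^ s := by ring
        _ ≤ B.card * 15 * 16 ^ s := Nat.mul_le_mul_right _ (by omega)
        _ = B.card * 16 ^ s * 15 := by ring
        _ ≤ T.card * 15 ^ s * 15 := Nat.mul_le_mul_right _ hT
        _ = _ := by ring

end Restriction

/-! ### Restrictions of twin polynomials -/

section Restrict

variable {ι κ : Type} {F : Finset κ}

open Classical in
/-- The value of a variable when the columns outside `F` are assigned by `v`. -/
def restrictVar (F : Finset κ) (v : κ → Bool) (x : ι × κ) : MvPolynomial (ι × F) ℚ :=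
  if h : x.2 ∈ F then X (x.1, ⟨x.2, h⟩) else if v x.2 = true then 1 else 0

/-- Assign the columns outside `F` by `v` and eliminate the twin variables. -/
def restrict (F : Finset κ) (v : κ → Bool) : TwinPoly (ι × κ) →ₐ[ℚ] MvPolynomial (ι × F) ℚ :=
  aeval (Sum.elim (restrictVar F v) fun x => 1 - restrictVar F v x)

/-- The literal of row `i` and column `c` that is `1` on the value `b` occurs in a monomial. -/
def Occurs (m : (ι × κ) ⊕ (ι × κ) →₀ ℕ) (i : ι) (c : κ) (b : Bool) : Prop :=
  m (if b = true then Sum.inl (i, c) else Sum.inr (i, c)) ≠ 0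

lemma restrict_inl (v : κ → Bool) (x : ι × κ) :
    restrict F v (X (Sum.inl x)) = restrictVar F v x := by
  simp [restrict]

lemma restrict_inr (v : κ → Bool) (x : ι × κ) :
    restrict F v (X (Sum.inr x)) = 1 - restrictVar F v x := by
  simp [restrict]

lemma restrict_monomial_eq_zero {v : κ → Bool} {m : (ι × κ) ⊕ (ι × κ) →₀ ℕ} (a : ℚ)
    (h : Killed Occurs F v m) : restrict F v (monomial m a) = 0 := by
  obtain ⟨i, c, b, hc, hR, hb⟩ := h
  rw [restrict, aeval_monomial, Finsupp.prod]
  refine mul_eq_zero_of_right _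
    (Finset.prod_eq_zero (Finsupp.mem_support_iff.2 hR) (pow_eq_zero_iff hR |>.2 ?_))
  cases b <;> simp_all [restrictVar]

lemma restrict_monomial_mem_supported (v : κ → Bool) (m : (ι × κ) ⊕ (ι × κ) →₀ ℕ) (a : ℚ) :
    restrict F v (monomial m a) ∈ supported ℚ {x : ι × F | ∃ b, Occurs m x.1 x.2 b} := by
  have hvar : ∀ (x : ι × κ) (b : Bool), Occurs m x.1 x.2 b →
      restrictVar F v x ∈ supported ℚ {x : ι × F | ∃ b, Occurs m x.1 x.2 b} := by
    intro x b hb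
    rw [restrictVar]
    split_ifs with h1 h2
    · rw [X_mem_supported]
      exact ⟨b, hb⟩
    · exact one_mem _
    · exact zero_mem _
  rw [restrict, aeval_monomial]
  refine mul_mem (Subalgebra.algebraMap_mem _ _) (prod_mem fun x hx => pow_mem ?_ _)
  rw [Finsupp.mem_support_iff] at hx
  rcases x with x | x
  · exact hvar x true hx
  · exact sub_mem (one_mem _) (hvar x false hx)

lemma restrict_monomial_mem_rowDegreeLE {v : κ → Bool} {m : (ι × κ) ⊕ (ι × κ) →₀ ℕ} (a : ℚ)
    {d : ℕ} (h : ¬ (¬ Killed Occurs F v m ∧ Wide Occurs F d m)) :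
    restrict F v (monomial m a) ∈ rowDegreeLE ι F d := by
  classical
  by_cases hk : Killed Occurs F v m
  · rw [restrict_monomial_eq_zero a hk]
    exact zero_mem _
  · rw [mem_rowDegreeLE]
    intro m' hm' i
    refine le_trans ?_ (not_lt.1 fun hlt => h ⟨hk, i, hlt⟩)
    refine Finset.card_le_card_of_injOn Subtype.val (fun c hc => ?_)
      Subtype.val_injective.injOn
    have hvars := mem_supported.1 (restrict_monomial_mem_supported (F := F) v m a)
    have hmem : (i, c) ∈ (restrict F v (monomial m a)).vars :=
      mem_vars_iff_mem_support _ |>.2 ⟨m', hm', by simpa [rowSupport] using hc⟩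
    exact mem_freeColumns.2 ⟨c.2, hvars hmem⟩

lemma restrict_mem_rowDegreeLE {v : κ → Bool} {d : ℕ} {q : TwinPoly (ι × κ)}
    (h : ∀ m ∈ q.support, ¬ (¬ Killed Occurs F v m ∧ Wide Occurs F d m)) :
    restrict F v q ∈ rowDegreeLE ι F d := by
  rw [q.as_sum, map_sum]
  exact Submodule.sum_mem _ fun m hm => restrict_monomial_mem_rowDegreeLE _ (h m hm)

variable [Fintype ι]

lemma pseudoExp_restrictVar_sq_mul (r : ι → ℚ) (v : κ → Bool) (x : ι × κ)
    (q : MvPolynomial (ι × F) ℚ) :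
    pseudoExp r (restrictVar F v x ^ 2 * q) = pseudoExp r (restrictVar F v x * q) := by
  rw [restrictVar]
  split_ifs
  · exact pseudoExp_X_sq_mul r _ q
  · rw [one_pow]
  · rw [zero_pow two_ne_zero]

lemma pseudoExp_restrict_X_sq_mul (r : ι → ℚ) (v : κ → Bool) (x : (ι × κ) ⊕ (ι × κ))
    (q : MvPolynomial (ι × F) ℚ) :
    pseudoExp r (restrict F v (X x) ^ 2 * q) = pseudoExp r (restrict F v (X x) * q) := by
  rcases x with x | x
  · rw [restrict_inl, pseudoExp_restrictVar_sq_mul]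
  · rw [restrict_inr, show (1 - restrictVar F v x) ^ 2 * q =
      (1 - restrictVar F v x) * q - restrictVar F v x * q + restrictVar F v x ^ 2 * q by ring,
      map_add, map_sub, pseudoExp_restrictVar_sq_mul, sub_add_cancel]

lemma pseudoExp_restrict_logical_sq (r : ι → ℚ) (v : κ → Bool) {q : TwinPoly (ι × κ)}
    (hq : q ∈ logicalAxioms (ι × κ)) : pseudoExp r (restrict F v q ^ 2) = 0 := by
  obtain ⟨x, rfl | rfl⟩ := hq
  · rw [map_sub (restrict F v), map_pow (restrict F v), sq (_ - _), sub_mul, map_sub, pseudoExp_restrict_X_sq_mul, sub_self]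
  · rw [map_sub, map_add, restrict_inl, restrict_inr, map_one]
    simp

end Restrict

/-! ### Lengths of encodings -/

lemma lt_two_pow_and_length_encodeNat (k : ℕ) :
    k < 2 ^ k.size ∧ (encodeNat k).length = 2 * k.size + 1 := by
  refine ⟨Nat.lt_size_self k, ?_⟩
  rw [encodeNat, List.length_append, List.length_flatMap, ← Nat.size_eq_bits_len]
  simp [mul_comm]

/-- Each binary digit of the numerator takes two bits, which pays for the square. -/
lemma sq_le_two_pow_length_encodeRat (a : ℚ) : a ^ 2 ≤ 2 ^ (encodeRat a).length := by
  obtain ⟨h1, h2⟩ := lt_two_pow_and_length_encodeNat a.num.natAbs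
  have hlen : 2 * a.num.natAbs.size ≤ (encodeRat a).length := by
    rw [encodeRat, List.length_cons, List.length_append, h2]
    omega
  have hden : (1 : ℚ) ≤ a.den := by exact_mod_cast a.den_pos
  have habs : |a| ≤ (a.num.natAbs : ℚ) := by
    conv_lhs => rw [← Rat.num_div_den a]
    rw [abs_div, Nat.abs_cast, Nat.cast_natAbs, Int.cast_abs]
    exact div_le_self (abs_nonneg _) hden
  have h3 : (a.num.natAbs : ℚ) ≤ 2 ^ a.num.natAbs.size := by exact_mod_cast h1.le
  calc a ^ 2 = |a| ^ 2 := (sq_abs a).symm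
    _ ≤ (2 ^ a.num.natAbs.size) ^ 2 := by gcongr; exact habs.trans h3
    _ = 2 ^ (2 * a.num.natAbs.size) := by rw [← pow_mul, mul_comm]
    _ ≤ _ := pow_le_pow_right₀ one_le_two hlen

lemma two_le_length_encodeRat (a : ℚ) : 2 ≤ (encodeRat a).length := by
  rw [encodeRat, List.length_cons, List.length_append,
    (lt_two_pow_and_length_encodeNat _).2, (lt_two_pow_and_length_encodeNat _).2]
  omega

lemma two_mul_sq_add_sq_le {ι : Type} {m : ℕ} (j k : Fin m) (a b : ℚ) :
    2 * (a ^ 2 + b ^ 2) ≤ 2 ^ (encodeScalars (Rule.linComb j k a b : Rule ι m)).length := by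
  have ha := sq_le_two_pow_length_encodeRat a
  have hb := sq_le_two_pow_length_encodeRat b
  -- With both powers at least `4`, their product dominates their sum.
  have h4 : ∀ c : ℚ, (4 : ℚ) ≤ 2 ^ (encodeRat c).length := fun c =>
    le_trans (by norm_num) (pow_le_pow_right₀ one_le_two (two_le_length_encodeRat c))
  rw [encodeScalars, List.length_cons, List.length_append,
    pow_succ _ (_ + _), pow_add _ (List.length _)]
  nlinarith [h4 a, h4 b]

lemma card_support_le_length_encodePoly {ι : Type} [Encodable ι] (p : TwinPoly ι) :
    p.support.card ≤ (encodePoly p).length := by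
  rw [encodePoly, List.length_append, List.length_flatMap, Finset.sum_map_toList,
    Finset.card_eq_sum_ones]
  refine le_add_right (Finset.sum_le_sum fun m _ => ?_)
  rw [List.length_cons]
  omega

lemma length_encodeProof {ι : Type} [Encodable ι] {m : ℕ} (p : Fin m → TwinPoly ι)
    (r : Fin m → Rule ι m) : (encodeProof p r).length =
      ∑ i, ((encodePoly (p i)).length + (encodeScalars (r i)).length + 1) + 1 := by
  rw [encodeProof, List.length_append, List.length_flatMap, Fin.sum_univ_def]
  simp

/-- A proof is attained with some choice of rules at its bit-complexity. -/
lemma exists_length_eq_bitComplexity {ι : Type} [Encodable ι] {ℓ : ℕ} {Q : Set (TwinPoly ι)}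
    {f : TwinPoly ι} {p : Fin (ℓ + 1) → TwinPoly ι} (h : IsProof Q f p) :
    ∃ r : Fin (ℓ + 1) → Rule ι (ℓ + 1),
      (∀ i, Justifies Q p i (r i)) ∧ (encodeProof p r).length = bitComplexity Q p := by
  choose r hr using h.1
  exact Nat.sInf_mem (s := {b : ℕ | ∃ r : Fin (ℓ + 1) → Rule ι (ℓ + 1),
    (∀ i, Justifies Q p i (r i)) ∧ (encodeProof p r).length = b}) ⟨_, r, hr, rfl⟩

/-! ### The growth of squares along a proof -/

/-- If `E` is nonnegative on squares from `V`, then along a proof whose lines lie in `V` the values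
of `E` on the squares of the lines grow at most by the scalars of the linear combinations. -/
lemma sq_le_of_justifies {ι A : Type} [CommRing A] [Algebra ℚ A] {m : ℕ} {Q : Set (TwinPoly ι)}
    {p : Fin m → TwinPoly ι} {r : Fin m → Rule ι m} (hp : ∀ i, Justifies Q p i (r i))
    (Φ : TwinPoly ι →ₐ[ℚ] A) (E : A →ₗ[ℚ] ℚ) (V : Submodule ℚ A) {η : ℚ} (hη : 0 ≤ η)
    (hV : ∀ i, Φ (p i) ∈ V) (hpos : ∀ q ∈ V, 0 ≤ E (q ^ 2))
    (hX : ∀ x q, E (Φ (X x) ^ 2 * q) = E (Φ (X x) * q))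
    (hQ : ∀ q ∈ Q, E (Φ q ^ 2) ≤ η) (hlog : ∀ q ∈ logicalAxioms ι, E (Φ q ^ 2) ≤ η) (i : Fin m) :
    E (Φ (p i) ^ 2) ≤ η * 2 ^ ∑ k ∈ Finset.Iic i, (encodeScalars (r k)).length := by
  induction i using WellFoundedLT.induction with
  | ind i ih =>
  have hbase : η ≤ η * 2 ^ ∑ k ∈ Finset.Iic i, (encodeScalars (r k)).length :=
    le_mul_of_one_le_right hη (one_le_pow₀ one_le_two)
  have hmono : ∀ j < i, E (Φ (p j) ^ 2) ≤
      η * 2 ^ ∑ k ∈ Finset.Iio i, (encodeScalars (r k)).length := by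
    intro j hj
    refine (ih j hj).trans (mul_le_mul_of_nonneg_left
      (pow_le_pow_right₀ one_le_two (Finset.sum_le_sum_of_subset fun k hk => ?_)) hη)
    exact Finset.mem_Iio.2 ((Finset.mem_Iic.1 hk).trans_lt hj)
  have hsum : ∑ k ∈ Finset.Iic i, (encodeScalars (r k)).length =
      (encodeScalars (r i)).length + ∑ k ∈ Finset.Iio i, (encodeScalars (r k)).length := by
    rw [← Finset.Iio_insert, Finset.sum_insert (by simp)]
  have hi := hp i
  rcases hri : r i with _ | _ | ⟨j, x⟩ | ⟨j, k, a, b⟩ <;> rw [hri] at hi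
  · exact (hQ _ hi).trans hbase
  · exact (hlog _ hi).trans hbase
  · obtain ⟨hj, hpi⟩ := hi
    -- By `x^2 = x`, `E((p - xp)^2) = E(p^2) - E((xp)^2)`, and this is nonnegative because both
    -- lines lie in `V`.
    have h0 := hpos _ (sub_mem (hV j) (hV i))
    have h1 := hX x (Φ (p j) ^ 2)
    have h2 : Φ (p i) = Φ (X x) * Φ (p j) := by rw [hpi, map_mul]
    rw [h2, show (Φ (p j) - Φ (X x) * Φ (p j)) ^ 2 = Φ (p j) ^ 2 - Φ (X x) * Φ (p j) ^ 2 -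
      Φ (X x) * Φ (p j) ^ 2 + Φ (X x) ^ 2 * Φ (p j) ^ 2 by ring, map_add, map_sub, map_sub, h1] at h0
    rw [h2, mul_pow, h1]
    have h3 : E (Φ (p j) ^ 2) ≤ _ := (hmono j hj).trans (mul_le_mul_of_nonneg_left
      (pow_le_pow_right₀ one_le_two (hsum ▸ Nat.le_add_left _ _)) hη)
    linarith
  · obtain ⟨hj, hk, hpi⟩ := hi
    have h2 : Φ (p i) = a • Φ (p j) + b • Φ (p k) := by
      rw [hpi, map_add, ← smul_eq_C_mul, ← smul_eq_C_mul, map_smul, map_smul]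
    have h0 := hpos _ (sub_mem (V.smul_mem a (hV j)) (V.smul_mem b (hV k)))
    -- Parallelogram law; the square of the difference is then dropped.
    have h1 : E ((a • Φ (p j) + b • Φ (p k)) ^ 2) + E ((a • Φ (p j) - b • Φ (p k)) ^ 2) =
        2 * (a ^ 2 * E (Φ (p j) ^ 2) + b ^ 2 * E (Φ (p k) ^ 2)) := by
      rw [← map_add, show (a • Φ (p j) + b • Φ (p k)) ^ 2 + (a • Φ (p j) - b • Φ (p k)) ^ 2 =
        (2 : ℚ) • (a • Φ (p j)) ^ 2 + (2 : ℚ) • (b • Φ (p k)) ^ 2 by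
          rw [two_smul, two_smul]; ring, smul_pow, smul_pow]
      simp only [map_add, map_smul, smul_eq_mul]
      ring
    rw [h2, hsum, pow_add, hri]
    have h3 := mul_le_mul_of_nonneg_left (hmono j hj) (sq_nonneg a)
    have h4 := mul_le_mul_of_nonneg_left (hmono k hk) (sq_nonneg b)
    have h5 := mul_le_mul_of_nonneg_right (two_mul_sq_add_sq_le (ι := ι) j k a b)
      (mul_nonneg hη (pow_nonneg zero_le_two (∑ k ∈ Finset.Iio i, (encodeScalars (r k)).length)))
    linarith

/-! ### The constraints under a pseudo-expectation -/

/-- The number by which `ks i` is forced to act. -/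
def ksValue {n : ℕ} (i : Fin n) : ℚ := (1 / 2) ^ 2 ^ (i : ℕ)

lemma ksValue_pos {n : ℕ} (i : Fin n) : 0 < ksValue i := by
  unfold ksValue; positivity

lemma ksValue_le_half {n : ℕ} (i : Fin n) : ksValue i ≤ 1 / 2 :=
  pow_le_of_le_one (by norm_num) (by norm_num) (by positivity)

section Constraints

variable {n s m : ℕ} {F : Finset (Fin (2 * n))} {v : Fin (2 * n) → Bool}

/-- Each row has exactly `s` ones outside `F`, lowering the constant from `n` to `m`; when `F.card =
2 * m` this is again of the form `ks`. -/
lemma restrict_ks (hv : (Fᶜ.filter fun c => v c = true).card = s)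
    (hm : m + s = n) (i : Fin n) :
    restrict F v (ks i) = ∑ c : F, X (i, c) - C (m : ℚ) := by
  have hC : C (σ := Fin n × F) (n : ℚ) = C (m : ℚ) + C (s : ℚ) := by
    rw [← C_add, ← Nat.cast_add, hm]
  rw [ks, map_sub, map_sum, ← algebraMap_eq, AlgHom.commutes, algebraMap_eq, hC,
    ← Finset.sum_add_sum_compl F]
  have h1 : ∑ c ∈ F, restrict F v (X (Sum.inl (i, c))) = ∑ c : F, X (i, c) := by
    rw [← Finset.sum_coe_sort F]
    refine Finset.sum_congr rfl fun c _ => ?_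
    rw [restrict_inl, restrictVar, dif_pos c.2]
  have h2 : ∑ c ∈ Fᶜ, restrict F v (X (Sum.inl (i, c))) = C (s : ℚ) := by
    rw [Finset.sum_congr rfl (g := fun c => if v c = true then 1 else 0) fun c hc => by
      rw [restrict_inl, restrictVar, dif_neg (Finset.mem_compl.1 hc)], Finset.sum_boole, hv]
    simp
  rw [h1, h2]
  ring

/-- The pseudo-expectation that satisfies all the constraints but the last one. -/
def ksExp (n m : ℕ) (F : Finset (Fin (2 * n))) : MvPolynomial (Fin n × F) ℚ →ₗ[ℚ] ℚ :=
  pseudoExp fun i => m + ksValue i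

lemma totalDegree_restrict_ks_le
    (hv : (Fᶜ.filter fun c => v c = true).card = s) (hm : m + s = n) (i : Fin n) :
    (restrict F v (ks i)).totalDegree ≤ 1 := by
  rw [restrict_ks hv hm]
  exact (totalDegree_sub_C_le _ _).trans
    (totalDegree_finsetSum_le fun c _ => (totalDegree_X _).le)

lemma ksExp_restrict_ks_mul (hF : F.card = 2 * m)
    (hv : (Fᶜ.filter fun c => v c = true).card = s) (hm : m + s = n) (i : Fin n)
    {q : MvPolynomial (Fin n × F) ℚ} (hq : q.totalDegree < 2 * m) :
    ksExp n m F (restrict F v (ks i) * q) = ksValue i * ksExp n m F q := by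
  have h := pseudoExp_sum_row_mul (fun i : Fin n => (m : ℚ) + ksValue i) i (q := q)
    (by rwa [Fintype.card_coe, hF])
  rw [restrict_ks hv hm, sub_mul, map_sub, ← smul_eq_C_mul, map_smul, ksExp, h, smul_eq_mul]
  ring

/-- The squares expand into products of at most four `ks`, whose values are pulled out one at a
time; the cofactors have degree at most `3`, whence `3 < 2 * m`. -/
lemma ksExp_constraint_sq_le (hF : F.card = 2 * m)
    (hv : (Fᶜ.filter fun c => v c = true).card = s) (hm : m + s = n) (hm3 : 3 < 2 * m)
    {q : TwinPoly (Fin n × Fin (2 * n))} (hq : q ∈ constraintsQ n) :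
    ksExp n m F (restrict F v q ^ 2) ≤ (1 / 2) ^ 2 ^ (n + 1) := by
  set k := fun i : Fin n => restrict F v (ks i) with hk
  have hdeg : ∀ i, (k i).totalDegree ≤ 1 := totalDegree_restrict_ks_le hv hm
  have h0 : ksExp n m F 1 = 1 := pseudoExp_one _
  have hmul : ∀ i q, q.totalDegree ≤ 3 → ksExp n m F (k i * q) = ksValue i * ksExp n m F q :=
    fun i q hq => ksExp_restrict_ks_mul hF hv hm i (by omega)
  have h1 : ∀ i, ksExp n m F (k i) = ksValue i := fun i => by
    have := hmul i 1 (by simp)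
    rwa [h0, mul_one, mul_one] at this
  have h2 : ∀ i j, ksExp n m F (k i * k j) = ksValue i * ksValue j := fun i j => by
    rw [hmul i (k j) ((hdeg j).trans (by norm_num)), h1]
  have hd2 : ∀ i j, (k i * k j).totalDegree ≤ 2 := fun i j =>
    (totalDegree_mul _ _).trans (Nat.add_le_add (hdeg i) (hdeg j))
  have h3 : ∀ i j l, ksExp n m F (k i * (k j * k l)) = ksValue i * (ksValue j * ksValue l) :=
    fun i j l => by rw [hmul i _ ((hd2 j l).trans (by norm_num)), h2]
  have h4 : ∀ i, ksExp n m F (k i * (k i * (k i * k i))) = ksValue i ^ 4 := fun i => by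
    rw [hmul i _ ((totalDegree_mul _ _).trans (Nat.add_le_add (hdeg i) (hd2 i i))), h3]
    ring
  have hpos : (0 : ℚ) ≤ (1 / 2) ^ 2 ^ (n + 1) := by positivity
  rcases hq with ⟨i, hi, rfl⟩ | ⟨i, j, hij, rfl⟩ | ⟨i, hi, rfl⟩
  · refine le_of_eq_of_le ?_ hpos
    have hval : ksValue i = 1 / 2 := by simp [ksValue, hi]
    have hC : restrict (ι := Fin n) F v (C (1 / 2)) = C (1 / 2) := by
      rw [← algebraMap_eq, AlgHom.commutes, algebraMap_eq]
    rw [map_sub (restrict F v), hC, show (k i - C (1 / 2)) ^ 2 =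
      k i * k i - C (1 / 2) * k i - C (1 / 2) * k i + C (1 / 2) * (C (1 / 2) * 1) by ring]
    simp only [map_add, map_sub, ← smul_eq_C_mul, map_smul, h2, h1, h0, hval, smul_eq_mul]
    norm_num
  · refine le_of_eq_of_le ?_ hpos
    have hval : ksValue j = ksValue i ^ 2 := by
      rw [ksValue, ksValue, ← pow_mul, hij, pow_succ]
    rw [map_sub (restrict F v), map_pow (restrict F v), show (k i ^ 2 - k j) ^ 2 = k i * (k i * (k i * k i)) -
      k i * (k i * k j) - k i * (k i * k j) + k j * k j by ring]
    simp only [map_add, map_sub, h2, h3, h4, hval]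
    ring
  · refine le_of_eq ?_
    rw [map_pow (restrict F v), show (k i ^ 2) ^ 2 = k i * (k i * (k i * k i)) by ring, h4, ksValue, ← pow_mul,
      show n + 1 = (i : ℕ) + 2 by omega, pow_add 2 _ 2]
    norm_num

/-- The row sum `m + ksValue i` lies near the middle of `[0, 2m]`, which leaves room for `2d` ones
and `d` zeros. -/
lemma ksExp_sq_nonneg (hF : F.card = 2 * m) {d : ℕ} (hd : 2 * d ≤ m)
    {q : MvPolynomial (Fin n × F) ℚ} (hq : q ∈ rowDegreeLE (Fin n) F d) :
    0 ≤ ksExp n m F (q ^ 2) := by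
  have hd' : 2 * (d : ℚ) ≤ m := by exact_mod_cast hd
  have hd0 : (0 : ℚ) ≤ d := Nat.cast_nonneg d
  have hcard : (Fintype.card F : ℚ) = 2 * m := by
    rw [Fintype.card_coe, hF]
    push_cast
    rfl
  refine pseudoExp_sq_nonneg _ (d := d) (by rw [Fintype.card_coe]; omega) (fun i => ?_)
    (fun i => ?_) (fun i a ha => ?_) hq
  · linarith [ksValue_pos i]
  · rw [hcard]
    linarith [ksValue_le_half i]
  · have : (a : ℚ) < d := by exact_mod_cast ha
    have := ksValue_pos i
    exact ne_of_gt (by linarith)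

end Constraints

/-! ### The lower bound -/

/-- A refutation of `Q_n` has either many monomials or long scalars. -/
lemma le_or_le_of_isRefutation {n ℓ : ℕ} (hn : 3 ≤ n)
    {p : Fin (ℓ + 1) → TwinPoly (Fin n × Fin (2 * n))} (hp : IsRefutation (constraintsQ n) p) :
    2 ^ (n + 1) ≤ bitComplexity (constraintsQ n) p ∨
      16 ^ (n / 2) ≤ bitComplexity (constraintsQ n) p * 15 ^ (n / 2) := by
  classical
  obtain ⟨r, hr, hlen⟩ := exists_length_eq_bitComplexity hp
  rw [← hlen, length_encodeProof]
  set T := Finset.univ.biUnion fun i => (p i).support with hT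
  -- The width `d = n / 4` satisfies both `2n ≤ 8(d+1)`, for the restriction, and `2d ≤ n - n / 2`,
  -- for positivity.
  obtain ⟨F, v, hF, hv, hbad⟩ := exists_balanced_restriction (ι := Fin n) Occurs (n / 4)
    (by rw [Fintype.card_fin]; omega) T (n / 2) (by rw [Fintype.card_fin]; omega)
  have hTcard : T.card ≤ ∑ i, (encodePoly (p i)).length :=
    Finset.card_biUnion_le.trans
      (Finset.sum_le_sum fun i _ => card_support_le_length_encodePoly (p i))
  rw [Finset.sum_add_distrib, Finset.sum_add_distrib]
  by_cases hlarge : 16 ^ (n / 2) ≤ T.card * 15 ^ (n / 2)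
  · right
    exact hlarge.trans (Nat.mul_le_mul_right _ (by omega))
  left
  -- The number of surviving wide monomials is an integer less than `1`.
  have hnone : (T.filter fun a => ¬ Killed Occurs F v a ∧ Wide Occurs F (n / 4) a) = ∅ := by
    by_contra hne
    have := Finset.card_pos.2 (Finset.nonempty_iff_ne_empty.2 hne)
    exact hlarge ((Nat.le_mul_of_pos_left _ this).trans hbad)
  rw [Finset.filter_eq_empty_iff] at hnone
  rw [Fintype.card_fin] at hF
  have hF' : F.card = 2 * (n - n / 2) := by omega
  have hm : n - n / 2 + n / 2 = n := by omega
  have hbound := sq_le_of_justifies hr (restrict F v) (ksExp n (n - n / 2) F)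
    (rowDegreeLE (Fin n) F (n / 4)) (η := (1 / 2) ^ 2 ^ (n + 1)) (by positivity)
    (fun i => restrict_mem_rowDegreeLE fun m hm =>
      hnone (Finset.mem_biUnion.2 ⟨i, Finset.mem_univ i, hm⟩))
    (fun q hq => ksExp_sq_nonneg hF' (by omega) hq)
    (fun x q => pseudoExp_restrict_X_sq_mul _ v x q)
    (fun q hq => ksExp_constraint_sq_le hF' hv hm (by omega) hq)
    (fun q hq => (pseudoExp_restrict_logical_sq _ v hq).trans_le (by positivity)) (Fin.last ℓ)
  have hone : ksExp n (n - n / 2) F 1 = 1 := pseudoExp_one _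
  rw [hp.2, map_one, one_pow, hone, one_div_pow, one_div, ← div_eq_inv_mul,
    one_le_div (by positivity)] at hbound
  have hpow := (pow_le_pow_iff_right₀ (one_lt_two (α := ℚ))).1 hbound
  have hsub : ∑ k ∈ Finset.Iic (Fin.last ℓ), (encodeScalars (r k)).length ≤
      ∑ k, (encodeScalars (r k)).length :=
    Finset.sum_le_sum_of_subset (Finset.subset_univ _)
  omega

end PCR

end

theorem mainTheorem4 :
    ∃ c : ℝ, 0 < c ∧ ∃ N : ℕ, ∀ n : ℕ, N ≤ n →
      ∀ (ℓ : ℕ) (p : Fin (ℓ + 1) → PCR.TwinPoly (Fin n × Fin (2 * n))),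
        PCR.IsRefutation (PCR.constraintsQ n) p →
          (2 : ℝ) ^ (c * (n : ℝ)) ≤ (PCR.bitComplexity (PCR.constraintsQ n) p : ℝ) := by
  have hlog : 0 < Real.logb 2 (16 / 15) := Real.logb_pos (by norm_num) (by norm_num)
  -- The rounded-down `n / 2` is at least the real number `n/4`.
  refine ⟨Real.logb 2 (16 / 15) / 4, by positivity, 3, fun n hn ℓ p hp => ?_⟩
  have hs : (n : ℝ) / 4 ≤ (n / 2 : ℕ) := by
    have : n ≤ 4 * (n / 2) := by omega
    have : (n : ℝ) ≤ 4 * (n / 2 : ℕ) := by exact_mod_cast this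
    linarith
  have hpow : (2 : ℝ) ^ (Real.logb 2 (16 / 15) / 4 * (n : ℝ)) ≤ (16 / 15) ^ (n / 2) := by
    rw [show Real.logb 2 (16 / 15) / 4 * (n : ℝ) = Real.logb 2 (16 / 15) * (n / 4) by ring,
      Real.rpow_mul zero_le_two, Real.rpow_logb zero_lt_two (by norm_num) (by norm_num),
      ← Real.rpow_natCast]
    exact Real.rpow_le_rpow_of_exponent_le (by norm_num) hs
  refine hpow.trans ?_
  rcases PCR.le_or_le_of_isRefutation hn hp with h | h
  · calc ((16 : ℝ) / 15) ^ (n / 2) ≤ 2 ^ (n / 2) :=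
          pow_le_pow_left₀ (by norm_num) (by norm_num) _
      _ ≤ 2 ^ (n + 1) := pow_le_pow_right₀ one_le_two (by omega)
      _ ≤ _ := by exact_mod_cast h
  · rw [div_pow, div_le_iff₀ (by positivity)]
    exact_mod_cast h
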